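/- Let $\xi=\{\xi(k)\}_{k\in\mathbb Z}$ be i.i.d. non-negative random variables, $a>0$, and let $b=\{b(j)\}_{j\ge1}$ be a non-negative real sequence which is not identically zero. Put $\lambda_1=\mathbb E[\xi(0)]$ and $\sigma^2=\operatorname{Var}[\xi(0)]$, and assume $\lambda_1\in(0,\infty)$ and $\sigma\in(0,\infty)$. Let $X=\{X(k)\}_{k\in\mathbb Z}$ be a weakly stationary solution (finite variances, constant mean, and $\operatorname{Cov}[X(n),X(n+k)]$ independent of $n$) of the ARCH($\infty$) equations $$X(k)=\varsigma(k)\,\xi(k),\qquad \varsigma(k)=a+\sum_{j=1}^\infty b(j)X(k-j)\qquad\text{a.s.},\quad k\in\mathbb Z,$$ and let $\rho(k)=\operatorname{Cov}[X(n),X(n+k)]$ be its autocovariance function. Assume - $(\mathrm S_1)$: $\lambda_1\sum_{j=1}^\infty b(j)<1$, and - $(\mathrm S_2)$: $\dfrac{\sigma}{\lambda_1}\Bigl(\sum_{j=1}^\infty z(j)^2\Bigr)^{1/2}<1$, where $z$ is defined by $\dfrac{1}{1-\lambda_1\sum_{j=1}^\infty b(j)\lambda^j}=\sum_{j=0}^\infty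 z(j)\lambda^j$, $|\lambda|\le1$. Then the following are equivalent: (a) there exist $\alpha_1\in(0,1)$ and $C_1\in(0,\infty)$ such that $b(k)\le C_1\alpha_1^k$ for all integers $k\ge1$; (b) there exist $\alpha_2\in(0,1)$ and $C_2\in(0,\infty)$ such that $\rho(k)\le C_2\alpha_2^k$ for all integers $k\ge0$. -/

import Mathlib

open MeasureTheory ProbabilityTheory

noncomputable section

namespace ArchInfinity

/-- The conditional volatility `ς(k) = a + ∑_{j ≥ 1} b(j) X(k - j)`.
A kernel is a function `b : ℕ → ℝ` of which only the values `b j`, `j ≥ 1`, are ever used. -/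
def volatility {Ω : Type*} (a : ℝ) (b : ℕ → ℝ) (X : ℤ → Ω → ℝ) (k : ℤ) (ω : Ω) : ℝ :=
  a + ∑' j : ℕ, b (j + 1) * X (k - ((j : ℤ) + 1)) ω

/-- `X` satisfies the ARCH(∞) equations with parameters `a`, `b` and shocks `ξ`: the shocks are
i.i.d. and non-negative, `a` and `b` are non-negative, and for every `k` almost surely the series
in the volatility converges and `X(k) = ς(k) ξ(k)`. -/
structure IsSolution {Ω : Type*} [MeasurableSpace Ω] (P : Measure Ω) (a : ℝ) (b : ℕ → ℝ)
    (ξ X : ℤ → Ω → ℝ) : Prop where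
  shock_measurable : ∀ k, Measurable (ξ k)
  shock_indep : iIndepFun ξ P
  shock_identDistrib : ∀ k, IdentDistrib (ξ k) (ξ 0) P P
  shock_nonneg : ∀ k, ∀ᵐ ω ∂P, 0 ≤ ξ k ω
  a_nonneg : 0 ≤ a
  b_nonneg : ∀ j, 1 ≤ j → 0 ≤ b j
  summable : ∀ k, ∀ᵐ ω ∂P, Summable fun j : ℕ => b (j + 1) * X (k - ((j : ℤ) + 1)) ω
  equation : ∀ k, ∀ᵐ ω ∂P, X k ω = volatility a b X k ω * ξ k ω

/-- Weak stationarity of a sequence of random variables of finite variance: the mean is constant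
and the covariance of `X(n)` and `X(n + k)` depends on `k` only. -/
structure IsWeaklyStationary {Ω : Type*} [MeasurableSpace Ω] (P : Measure Ω)
    (X : ℤ → Ω → ℝ) : Prop where
  memLp : ∀ k, MemLp (X k) 2 P
  mean : ∀ k, ∫ ω, X k ω ∂P = ∫ ω, X 0 ω ∂P
  cov : ∃ ρ : ℤ → ℝ, ∀ n k : ℤ, ρ k = covariance (X n) (X (n + k)) P

/-- The autocovariance function `ρ(k) = Cov[X(0), X(k)]` of a weakly stationary sequence (by weak
stationarity, `ρ(k) = Cov[X(n), X(n + k)]` for all `n`). -/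
def autocovariance {Ω : Type*} [MeasurableSpace Ω] (P : Measure Ω) (X : ℤ → Ω → ℝ) (k : ℤ) : ℝ :=
  covariance (X 0) (X k) P

/-- The mean `λ₁ = E[ξ(0)]` of the shocks. -/
def shockMean {Ω : Type*} [MeasurableSpace Ω] (P : Measure Ω) (ξ : ℤ → Ω → ℝ) : ℝ :=
  ∫ ω, ξ 0 ω ∂P

/-- The standard deviation `σ` of the shocks, `σ² = Var[ξ(0)]`. -/
def shockStd {Ω : Type*} [MeasurableSpace Ω] (P : Measure Ω) (ξ : ℤ → Ω → ℝ) : ℝ :=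
  Real.sqrt (variance (ξ 0) P)

/-- The standing assumption: `λ₁ ∈ (0, ∞)`, `a > 0`, `σ ∈ (0, ∞)` and `b ≢ 0`.
Finiteness of `λ₁` and `σ` is square integrability of `ξ(0)`. -/
structure Standing {Ω : Type*} [MeasurableSpace Ω] (P : Measure Ω) (a : ℝ) (b : ℕ → ℝ)
    (ξ : ℤ → Ω → ℝ) : Prop where
  memLp : MemLp (ξ 0) 2 P
  mean_pos : 0 < shockMean P ξ
  a_pos : 0 < a
  std_pos : 0 < shockStd P ξ
  b_ne_zero : ∃ j, 1 ≤ j ∧ b j ≠ 0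

/-- The condition `l B < 1`, with `B = ∑_{j ≥ 1} b(j)` finite. -/
def CondS1 (l : ℝ) (b : ℕ → ℝ) : Prop :=
  Summable (fun j : ℕ => b (j + 1)) ∧ l * ∑' j : ℕ, b (j + 1) < 1

/-- The coefficients `z(j)` of the power series expansion
`1 / (1 - l ∑_{j ≥ 1} b(j) x^j) = ∑_{j ≥ 0} z(j) x^j`. -/
def resolvent (l : ℝ) (b : ℕ → ℝ) (j : ℕ) : ℝ :=
  PowerSeries.coeff j (1 - PowerSeries.mk fun i => if i = 0 then 0 else l * b i)⁻¹

/-- The condition `(s / l) (∑_{j ≥ 1} z(j)²)^{1/2} < 1`, in which the series is finite. -/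
def CondS2 (l s : ℝ) (b : ℕ → ℝ) : Prop :=
  Summable (fun j : ℕ => resolvent l b (j + 1) ^ 2) ∧
    s / l * Real.sqrt (∑' j : ℕ, resolvent l b (j + 1) ^ 2) < 1

end ArchInfinity

end

/-! Everything rests on the Yule–Walker equations `ρ(k) = λ₁ ∑ b(j) ρ(k - j)`, `k ≥ 1`. Since `λ₁ ∑
b(j) < 1`, iterating the bound `ρ ≥ -K` improves it geometrically, so `ρ ≥ 0`. Keeping one term of
the series gives `ρ(k) ≥ λ₁ b(k) ρ(0)` with `ρ(0) > 0`, so decay of `ρ` passes to `b`. Conversely,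
geometric decay of `b` leaves `λ₁ ∑ b(j) R^j < 1` for some `R > 1`, and induction bounds `ρ(k) R^k`.

The hard part is Yule–Walker itself. Factoring out `E[ξ(k)]` needs `ξ(k)` independent of `X(0)` and
`ς(k)`, but a solution is not assumed to be causal. Causality is proved in `exists_measurable_past`:
run the equations from time `t - n`; the values before `t - n` contribute to `X(t)`, in `L¹`, at
most a constant times the convolution of the tails of `b` with the `L²` norms of the impulse
response. The tails merely tend to zero, so these norms should be summable.

The impulse response is `z(n)` plus a combination of orthogonal martingale differences, so its
second moments `u` solve the renewal equation `u = z² + (σ/λ₁)² z² * u`, where the kernel is taken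
at indices `≥ 1`. By `(S₂)` the kernel has mass below 1, which controls `∑ u`, whereas `∑ √u` is
required. `(S₁)` puts `z` in `ℓ¹`, hence `z²` in `ℓ^{1/2}`, and the Wiener-type lemma
`tsum_rootSum_pow_ne_top` carries this over to `u`. -/

namespace ArchInfinity

/-! ### Impulse responses and the resolvent -/

open Finset

/-- The response at time `n` of the linear recursion `S(n) = ∑_{j < n} b(n - j) x(j) S(j)` to a
unit impulse at time `0`. -/
noncomputable def propagator (b x : ℕ → ℝ) (n : ℕ) : ℝ :=
  (if n = 0 then 1 else 0) + ∑ j : Fin n, b (n - j) * (x j * propagator b x j)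
termination_by n
decreasing_by exact j.2

theorem propagator_eq (b x : ℕ → ℝ) (n : ℕ) :
    propagator b x n =
      (if n = 0 then 1 else 0) + ∑ j ∈ range n, b (n - j) * (x j * propagator b x j) := by
  rw [propagator, Finset.sum_range]

theorem propagator_zero (b x : ℕ → ℝ) : propagator b x 0 = 1 := by
  simp [propagator_eq b x 0]

theorem coeff_mk_mul_mk {R : Type*} [CommSemiring R] (c d : ℕ → R) (n : ℕ) :
    PowerSeries.coeff n ((PowerSeries.mk fun i => if i = 0 then 0 else c i) * PowerSeries.mk d) =
      ∑ j ∈ range n, c (n - j) * d j := by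
  rw [mul_comm, PowerSeries.coeff_mul,
    Finset.Nat.sum_antidiagonal_eq_sum_range_succ (fun i j => PowerSeries.coeff i
      (PowerSeries.mk d) * PowerSeries.coeff j (PowerSeries.mk fun i => if i = 0 then 0 else c i)),
    Finset.sum_range_succ]
  simp only [PowerSeries.coeff_mk, Nat.sub_self, if_true, mul_zero, add_zero]
  refine Finset.sum_congr rfl fun j hj => ?_
  rw [if_neg (by have := Finset.mem_range.1 hj; omega), mul_comm]

section Resolvent

variable (l : ℝ) (b : ℕ → ℝ)

theorem mk_resolvent_mul :
    PowerSeries.mk (resolvent l b) *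
      (1 - PowerSeries.mk fun i => if i = 0 then 0 else l * b i) = 1 := by
  have : PowerSeries.mk (resolvent l b) =
      (1 - PowerSeries.mk fun i => if i = 0 then 0 else l * b i)⁻¹ := by
    ext n; simp [resolvent]
  rw [this]
  apply PowerSeries.inv_mul_cancel
  rw [← PowerSeries.coeff_zero_eq_constantCoeff_apply]
  simp

theorem resolvent_eq (n : ℕ) :
    resolvent l b n =
      (if n = 0 then 1 else 0) + ∑ j ∈ range n, l * b (n - j) * resolvent l b j := by
  have h := mk_resolvent_mul l b
  have h2 : PowerSeries.mk (resolvent l b) = 1 +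
      (PowerSeries.mk fun i => if i = 0 then 0 else l * b i) *
        PowerSeries.mk (resolvent l b) := by
    linear_combination h
  have h3 := congrArg (PowerSeries.coeff n) h2
  rw [map_add, coeff_mk_mul_mk (fun i => l * b i), PowerSeries.coeff_one,
    PowerSeries.coeff_mk] at h3
  exact h3

theorem resolvent_zero : resolvent l b 0 = 1 := by
  simp [resolvent_eq l b 0]

/-- Expansion of the propagator in the centred inputs. -/
theorem propagator_eq_resolvent_add (hl : l ≠ 0) (x : ℕ → ℝ) (n : ℕ) :
    propagator b x n = resolvent l b n +
      ∑ j ∈ range n, l⁻¹ * resolvent l b (n - j) * ((x j - l) * propagator b x j) := by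
  set B : PowerSeries ℝ := PowerSeries.mk fun i => if i = 0 then 0 else l * b i with hB
  set Z : PowerSeries ℝ := PowerSeries.mk (resolvent l b) with hZ
  set S : PowerSeries ℝ := PowerSeries.mk (propagator b x) with hS
  set Y : PowerSeries ℝ := PowerSeries.mk fun j => (x j - l) * propagator b x j with hY
  set Z' : PowerSeries ℝ :=
    PowerSeries.mk fun i => if i = 0 then 0 else l⁻¹ * resolvent l b i with hZ'
  have hZB : Z * (1 - B) = 1 := mk_resolvent_mul l b
  -- Split each input as `x j = l + (x j - l)`; multiplying by `Z = (1 - B)⁻¹` then solves for `S`.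
  have e1 : S = 1 + B * S + PowerSeries.C l⁻¹ * (B * Y) := by
    ext m
    rw [map_add, map_add, PowerSeries.coeff_C_mul, hB, hS, hY,
      coeff_mk_mul_mk (fun i => l * b i), coeff_mk_mul_mk (fun i => l * b i),
      PowerSeries.coeff_one, PowerSeries.coeff_mk, propagator_eq, Finset.mul_sum, add_assoc,
      ← Finset.sum_add_distrib]
    congr 1
    refine Finset.sum_congr rfl fun j _ => ?_
    field_simp
    ring
  have e2 : PowerSeries.C l⁻¹ * (Z - 1) = Z' := by
    ext m
    rw [PowerSeries.coeff_C_mul, map_sub, PowerSeries.coeff_one]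
    by_cases hm : m = 0
    · subst hm
      simp [hZ, hZ', resolvent_zero]
    · simp [hZ, hZ', hm]
  have e3 : S = Z + Z' * Y := by
    rw [← e2]
    linear_combination Z * e1 - (S + PowerSeries.C l⁻¹ * Y) * hZB
  have h3 := congrArg (PowerSeries.coeff n) e3
  rw [map_add, hZ', hY, coeff_mk_mul_mk (fun i => l⁻¹ * resolvent l b i)] at h3
  simpa [hS, hZ] using h3

variable {l b}

theorem resolvent_nonneg (hl : 0 ≤ l) (hb : ∀ j, 1 ≤ j → 0 ≤ b j) (n : ℕ) :
    0 ≤ resolvent l b n := by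
  induction n using Nat.strong_induction_on with
  | _ n ih =>
    rw [resolvent_eq]
    refine add_nonneg (by split_ifs <;> norm_num) (Finset.sum_nonneg fun j hj => ?_)
    have := Finset.mem_range.1 hj
    exact mul_nonneg (mul_nonneg hl (hb _ (by omega))) (ih j this)

/-- Summing the renewal equation gives `T ≤ 1 + c T` for each partial sum `T`, with `c < 1`. -/
theorem summable_resolvent (hl : 0 ≤ l) (hb : ∀ j, 1 ≤ j → 0 ≤ b j) (h : CondS1 l b) :
    Summable (resolvent l b) := by
  obtain ⟨hs, h1⟩ := h
  set c := l * ∑' j : ℕ, b (j + 1) with hc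
  have hz := resolvent_nonneg hl hb
  refine summable_of_sum_range_le (c := 1 / (1 - c)) hz fun N => ?_
  rw [le_div_iff₀ (by linarith)]
  set T := ∑ n ∈ range N, resolvent l b n with hT
  have key : T ≤ 1 + c * T := by
    have e : T = ∑ n ∈ range N, (if n = 0 then 1 else 0) +
        ∑ n ∈ range N, ∑ j ∈ range n, l * b (n - j) * resolvent l b j := by
      rw [hT, ← Finset.sum_add_distrib]
      exact Finset.sum_congr rfl fun n _ => resolvent_eq l b n
    rw [e]
    refine add_le_add ?_ ?_
    · rw [Finset.sum_ite_eq']; split_ifs <;> norm_num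
    · rw [← e]
      have hswap : ∑ n ∈ range N, ∑ j ∈ range n, l * b (n - j) * resolvent l b j =
          ∑ j ∈ range N, ∑ n ∈ Ico (j + 1) N, l * b (n - j) * resolvent l b j := by
        refine Finset.sum_comm' fun n j => ?_
        simp only [mem_range, mem_Ico]; omega
      rw [hswap, hT, Finset.mul_sum]
      refine Finset.sum_le_sum fun j _ => ?_
      rw [← Finset.sum_mul]
      refine mul_le_mul_of_nonneg_right ?_ (hz j)
      rw [← Finset.mul_sum, hc]
      refine mul_le_mul_of_nonneg_left ?_ hl
      rw [Finset.sum_Ico_eq_sum_range]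
      refine le_trans (le_of_eq ?_) (hs.sum_le_tsum (range (N - (j + 1)))
        fun i _ => hb _ (by omega))
      exact Finset.sum_congr rfl fun i _ => by congr 1; omega
  linarith

end Resolvent

/-! ### Renewal equations in `ℓ^{1/2}` -/

section RootSum

open ENNReal PowerSeries

/-- The `ℓ^{1/2}` quasi-norm `∑ √Fₙ` (without the outer square) of a power series with
coefficients in `[0, ∞]`. -/
noncomputable def rootSum (F : PowerSeries ℝ≥0∞) : ℝ≥0∞ := ∑' n, (coeff n F) ^ (1 / 2 : ℝ)

theorem sum_rpow_half_le {ι : Type*} (s : Finset ι) (f : ι → ℝ≥0∞) :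
    (∑ i ∈ s, f i) ^ (1 / 2 : ℝ) ≤ ∑ i ∈ s, f i ^ (1 / 2 : ℝ) := by
  classical
  induction s using Finset.induction_on with
  | empty => simp
  | insert i s hi ih =>
    rw [Finset.sum_insert hi, Finset.sum_insert hi]
    exact (ENNReal.rpow_add_le_add_rpow _ _ (by norm_num) (by norm_num)).trans
      (add_le_add le_rfl ih)

theorem rootSum_add_le (F G : PowerSeries ℝ≥0∞) : rootSum (F + G) ≤ rootSum F + rootSum G := by
  unfold rootSum
  rw [← ENNReal.tsum_add]
  refine ENNReal.tsum_le_tsum fun n => ?_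
  rw [map_add]
  exact ENNReal.rpow_add_le_add_rpow _ _ (by norm_num) (by norm_num)

theorem tsum_sum_antidiagonal (f : ℕ × ℕ → ℝ≥0∞) :
    ∑' n, ∑ p ∈ antidiagonal n, f p = ∑' p, f p := by
  have h := (Finset.HasAntidiagonal.sigmaAntidiagonalEquivProd (A := ℕ)).tsum_eq f
  rw [← h, ENNReal.tsum_sigma']
  refine tsum_congr fun n => ?_
  exact (Finset.sum_coe_sort (antidiagonal n) f).symm.trans (tsum_fintype _).symm

theorem rootSum_mul_le (F G : PowerSeries ℝ≥0∞) : rootSum (F * G) ≤ rootSum F * rootSum G := by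
  have h : rootSum F * rootSum G =
      ∑' n, ∑ p ∈ antidiagonal n, (coeff p.1 F) ^ (1 / 2 : ℝ) * (coeff p.2 G) ^ (1 / 2 : ℝ) := by
    rw [tsum_sum_antidiagonal
      fun p => (coeff p.1 F) ^ (1 / 2 : ℝ) * (coeff p.2 G) ^ (1 / 2 : ℝ),
      ENNReal.tsum_prod (f := fun i j => (coeff i F) ^ (1 / 2 : ℝ) * (coeff j G) ^ (1 / 2 : ℝ))]
    simp only [rootSum, ENNReal.tsum_mul_left, ENNReal.tsum_mul_right]
  rw [h, rootSum]
  refine ENNReal.tsum_le_tsum fun n => ?_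
  rw [coeff_mul]
  refine (sum_rpow_half_le _ _).trans (Finset.sum_le_sum fun p _ => ?_)
  rw [ENNReal.mul_rpow_of_nonneg _ _ (by norm_num)]

theorem rootSum_zero : rootSum 0 = 0 := by simp [rootSum]

theorem rootSum_one : rootSum 1 = 1 := by
  rw [rootSum, tsum_eq_single 0]
  · simp
  · intro n hn; simp [coeff_one, hn]

theorem rootSum_pow_le (F : PowerSeries ℝ≥0∞) (n : ℕ) : rootSum (F ^ n) ≤ rootSum F ^ n := by
  induction n with
  | zero => simp [rootSum_one]
  | succ n ih =>
    rw [pow_succ, pow_succ]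
    exact (rootSum_mul_le _ _).trans (mul_le_mul' ih le_rfl)

/-- The factor `√c` would be sharp, but with `c` the binomial theorem can be reassembled after
estimating term by term. -/
theorem rootSum_mul_natCast_le (F : PowerSeries ℝ≥0∞) (c : ℕ) :
    rootSum (F * c) ≤ rootSum F * c := by
  induction c with
  | zero => simp [rootSum_zero]
  | succ c ih =>
    push_cast
    rw [mul_add, mul_add, mul_one, mul_one]
    exact (rootSum_add_le _ _).trans (add_le_add ih le_rfl)

theorem rootSum_sum_le {ι : Type*} (s : Finset ι) (F : ι → PowerSeries ℝ≥0∞) :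
    rootSum (∑ i ∈ s, F i) ≤ ∑ i ∈ s, rootSum (F i) := by
  classical
  induction s using Finset.induction_on with
  | empty => simp [rootSum_zero]
  | insert i s hi ih =>
    rw [Finset.sum_insert hi, Finset.sum_insert hi]
    exact (rootSum_add_le _ _).trans (add_le_add le_rfl ih)

theorem sum_rpow_half_le_card_mul {ι : Type*} (s : Finset ι) (f : ι → ℝ≥0∞) :
    ∑ i ∈ s, f i ^ (1 / 2 : ℝ) ≤ #s * (∑ i ∈ s, f i) ^ (1 / 2 : ℝ) := by
  refine (Finset.sum_le_card_nsmul s _ ((∑ i ∈ s, f i) ^ (1 / 2 : ℝ)) fun i hi => ?_).trans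
    (le_of_eq (nsmul_eq_mul _ _))
  exact ENNReal.rpow_le_rpow (Finset.single_le_sum (fun _ _ => zero_le) hi) (by norm_num)

/-- Powers of a polynomial have small quasi-norm, as their degree grows linearly. -/
theorem rootSum_polynomial_pow_le (p : Polynomial ℝ≥0∞) (m : ℕ) :
    rootSum ((p : PowerSeries ℝ≥0∞) ^ m) ≤
      ((m * p.natDegree + 1 : ℕ) : ℝ≥0∞) * ((p.eval 1) ^ (1 / 2 : ℝ)) ^ m := by
  have hdeg : (p ^ m).natDegree < m * p.natDegree + 1 :=
    Nat.lt_succ_of_le Polynomial.natDegree_pow_le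
  have h1 : rootSum ((p : PowerSeries ℝ≥0∞) ^ m) =
      ∑ n ∈ range (m * p.natDegree + 1), ((p ^ m).coeff n) ^ (1 / 2 : ℝ) := by
    rw [← Polynomial.coe_pow, rootSum, tsum_eq_sum (s := range (m * p.natDegree + 1))]
    · simp only [Polynomial.coeff_coe]
    · intro n hn
      rw [Polynomial.coeff_coe, Polynomial.coeff_eq_zero_of_natDegree_lt
        (by rw [Finset.mem_range] at hn; omega)]
      simp
  have h2 : ∑ n ∈ range (m * p.natDegree + 1), (p ^ m).coeff n = (p.eval 1) ^ m := by
    rw [← Polynomial.eval_pow, Polynomial.eval_eq_sum_range' hdeg]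
    simp
  rw [h1]
  refine (sum_rpow_half_le_card_mul _ _).trans ?_
  rw [h2, Finset.card_range, ← ENNReal.rpow_natCast, ← ENNReal.rpow_natCast, ← ENNReal.rpow_mul,
    ← ENNReal.rpow_mul, mul_comm (1 / 2 : ℝ)]

theorem rootSum_polynomial_add_pow_le (p : Polynomial ℝ≥0∞) (T : PowerSeries ℝ≥0∞) (n : ℕ) :
    rootSum (((p : PowerSeries ℝ≥0∞) + T) ^ n) ≤
      ((n * p.natDegree + 1 : ℕ) : ℝ≥0∞) * ((p.eval 1) ^ (1 / 2 : ℝ) + rootSum T) ^ n := by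
  rw [add_pow, add_pow, Finset.mul_sum]
  refine (rootSum_sum_le _ _).trans (Finset.sum_le_sum fun k hk => ?_)
  have hk : k ≤ n := by rw [Finset.mem_range] at hk; omega
  calc _ ≤ rootSum ((p : PowerSeries ℝ≥0∞) ^ k * T ^ (n - k)) * (n.choose k) :=
        rootSum_mul_natCast_le _ _
    _ ≤ ((k * p.natDegree + 1 : ℕ) * ((p.eval 1) ^ (1 / 2 : ℝ)) ^ k * rootSum T ^ (n - k)) *
        (n.choose k) := by
        gcongr
        exact (rootSum_mul_le _ _).trans
          (mul_le_mul' (rootSum_polynomial_pow_le p k) (rootSum_pow_le T _))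
    _ ≤ ((n * p.natDegree + 1 : ℕ) * ((p.eval 1) ^ (1 / 2 : ℝ)) ^ k * rootSum T ^ (n - k)) *
        (n.choose k) := by gcongr
    _ = _ := by ring

theorem tsum_natCast_mul_pow_ne_top (L : ℕ) {r : ℝ≥0∞} (hr : r < 1) :
    ∑' n : ℕ, ((n * L + 1 : ℕ) : ℝ≥0∞) * r ^ n ≠ ∞ := by
  lift r to NNReal using hr.ne_top
  have hr' : (r : ℝ) < 1 := by exact_mod_cast hr
  have : ∀ n : ℕ, ((n * L + 1 : ℕ) : ℝ≥0∞) * (r : ℝ≥0∞) ^ n =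
      (((n * L + 1 : ℕ) * r ^ n : NNReal) : ℝ≥0∞) := fun n => by push_cast; rfl
  simp_rw [this]
  rw [ENNReal.tsum_coe_ne_top_iff_summable, ← NNReal.summable_coe]
  have h1 := summable_pow_mul_geometric_of_norm_lt_one (R := ℝ) 1 (r := r) (by simpa using hr')
  have h0 := summable_geometric_of_lt_one (NNReal.coe_nonneg r) hr'
  refine ((h1.mul_left (L : ℝ)).add h0).congr fun n => ?_
  push_cast
  ring

/-- A Wiener-type lemma: a defective kernel in `ℓ^{1/2}` has a renewal series in `ℓ^{1/2}`. -/
theorem tsum_rootSum_pow_ne_top (F : PowerSeries ℝ≥0∞) (hF : rootSum F ≠ ∞)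
    (h1 : ∑' n, coeff n F < 1) : ∑' n, rootSum (F ^ n) ≠ ∞ := by
  set θ : ℝ≥0∞ := (∑' n, coeff n F) ^ (1 / 2 : ℝ) with hθ
  have hθ1 : θ < 1 := ENNReal.rpow_lt_one h1 (by norm_num)
  have hlim := ENNReal.tendsto_sum_nat_add (fun n => (coeff n F) ^ (1 / 2 : ℝ)) hF
  -- Cut `F` so late that the tail has quasi-norm below `1 - θ`. The polynomial part costs at most
  -- `θ` per power, up to a factor linear in the exponent, so the powers of `F` decay geometrically.
  obtain ⟨L, hL⟩ := (hlim.eventually_lt_const (tsub_pos_of_lt hθ1)).exists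
  set T : PowerSeries ℝ≥0∞ := mk fun n => if n < L then 0 else coeff n F with hT
  have hsplit : F = (trunc L F : PowerSeries ℝ≥0∞) + T := by
    ext n
    rw [map_add, Polynomial.coeff_coe, coeff_trunc, hT, coeff_mk]
    split_ifs <;> simp
  have hTsum : rootSum T < 1 - θ := by
    refine lt_of_eq_of_lt ?_ hL
    rw [rootSum, ← ENNReal.summable.sum_add_tsum_nat_add' (k := L), Finset.sum_eq_zero, zero_add]
    · refine tsum_congr fun k => ?_
      simp [hT]
    · intro n hn
      simp [hT, Finset.mem_range.1 hn]
  have heval : ((trunc L F).eval 1) ^ (1 / 2 : ℝ) ≤ θ := by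
    refine ENNReal.rpow_le_rpow ?_ (by norm_num)
    rw [Polynomial.eval_eq_sum_range]
    refine le_trans (Finset.sum_le_sum fun n _ => ?_) (ENNReal.sum_le_tsum _)
    rw [coeff_trunc]
    split_ifs <;> simp
  have hr : ((trunc L F).eval 1) ^ (1 / 2 : ℝ) + rootSum T < 1 :=
    lt_of_le_of_lt (add_le_add heval le_rfl) (by
      have := ENNReal.add_lt_add_left hθ1.ne_top hTsum
      rwa [add_tsub_cancel_of_le hθ1.le] at this)
  refine ne_top_of_le_ne_top (tsum_natCast_mul_pow_ne_top (trunc L F).natDegree hr)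
    (ENNReal.tsum_le_tsum fun n => ?_)
  conv_lhs => rw [hsplit]
  exact rootSum_polynomial_add_pow_le _ _ _

/-- Iteration gives `U = ∑ F^k W`. As `F` has no constant term, each coefficient involves finitely
many `k`, so no convergence is needed. -/
theorem rootSum_ne_top_of_renewal {U W F : PowerSeries ℝ≥0∞} (hU : U = W + F * U)
    (hF0 : constantCoeff F = 0) (hW : rootSum W ≠ ∞) (hF : rootSum F ≠ ∞)
    (h1 : ∑' n, coeff n F < 1) : rootSum U ≠ ∞ := by
  have hiter : ∀ n : ℕ, U = ∑ k ∈ range n, F ^ k * W + F ^ n * U := by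
    intro n
    induction n with
    | zero => simp
    | succ n ih =>
      rw [Finset.sum_range_succ]
      calc U = ∑ k ∈ range n, F ^ k * W + F ^ n * U := ih
        _ = ∑ k ∈ range n, F ^ k * W + F ^ n * (W + F * U) := by rw [← hU]
        _ = _ := by ring
  have hcoeff : ∀ m, coeff m U = ∑ k ∈ range (m + 1), coeff m (F ^ k * W) := by
    intro m
    have h0 : coeff m (F ^ (m + 1) * U) = 0 := by
      obtain ⟨G, hG⟩ := PowerSeries.X_dvd_iff.2 hF0
      refine (PowerSeries.X_pow_dvd_iff (n := m + 1)).1 ⟨G ^ (m + 1) * U, ?_⟩ m (by omega)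
      rw [hG]; ring
    conv_lhs => rw [hiter (m + 1)]
    rw [map_add, h0, add_zero, map_sum]
  have hle : rootSum U ≤ ∑' k, rootSum (F ^ k * W) := by
    simp only [rootSum]
    rw [ENNReal.tsum_comm]
    refine ENNReal.tsum_le_tsum fun m => ?_
    rw [hcoeff]
    exact (sum_rpow_half_le _ _).trans (ENNReal.sum_le_tsum _)
  refine ne_top_of_le_ne_top ?_ (hle.trans (ENNReal.tsum_le_tsum fun k => rootSum_mul_le _ _))
  rw [ENNReal.tsum_mul_right]
  exact ENNReal.mul_ne_top (tsum_rootSum_pow_ne_top F hF h1) hW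

theorem rootSum_mk_ofReal_ne_top {f : ℕ → ℝ} (hf : ∀ n, 0 ≤ f n)
    (hs : Summable fun n => √(f n)) : rootSum (mk fun n => ENNReal.ofReal (f n)) ≠ ∞ := by
  have : rootSum (mk fun n => ENNReal.ofReal (f n)) = ∑' n, ENNReal.ofReal (√(f n)) := by
    refine tsum_congr fun n => ?_
    rw [coeff_mk, ENNReal.ofReal_rpow_of_nonneg (hf n) (by norm_num), Real.sqrt_eq_rpow]
  rw [this]
  exact hs.tsum_ofReal_ne_top

/-- The value `f 0` never enters the convolution, so it is replaced by 0 and only `f (n + 1)` is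
constrained. -/
theorem summable_sqrt_of_renewal {u w f : ℕ → ℝ} (hu : ∀ n, 0 ≤ u n) (hw : ∀ n, 0 ≤ w n)
    (hf : ∀ n, 0 ≤ f n) (heq : ∀ n, u n = w n + ∑ j ∈ range n, f (n - j) * u j)
    (hws : Summable fun n => √(w n)) (hfs : Summable fun n => √(f (n + 1)))
    (hfs' : Summable fun n => f (n + 1)) (hf1 : ∑' n, f (n + 1) < 1) :
    Summable fun n => √(u n) := by
  set U : PowerSeries ℝ≥0∞ := mk fun n => ENNReal.ofReal (u n)
  set W : PowerSeries ℝ≥0∞ := mk fun n => ENNReal.ofReal (w n)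
  set F : PowerSeries ℝ≥0∞ := mk fun n => if n = 0 then 0 else ENNReal.ofReal (f n) with hF
  have hU : U = W + F * U := by
    ext n
    rw [map_add, coeff_mk_mul_mk (fun n => ENNReal.ofReal (f n)), coeff_mk, coeff_mk, heq,
      ENNReal.ofReal_add (hw n)
        (Finset.sum_nonneg fun j _ => mul_nonneg (hf _) (hu _)),
      ENNReal.ofReal_sum_of_nonneg fun j _ => mul_nonneg (hf _) (hu _)]
    simp only [ENNReal.ofReal_mul (hf _)]
  have hF' : F = mk fun n => ENNReal.ofReal (if n = 0 then 0 else f n) := by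
    ext n
    rw [hF, coeff_mk, coeff_mk]
    split_ifs <;> simp
  have hFs : rootSum F ≠ ∞ := by
    rw [hF']
    refine rootSum_mk_ofReal_ne_top (fun n => by split_ifs; exacts [le_rfl, hf n]) ?_
    rw [← summable_nat_add_iff 1]
    simpa using hfs
  have hF1 : ∑' n, coeff n F < 1 := by
    rw [← ENNReal.summable.sum_add_tsum_nat_add' (k := 1)]
    simp only [hF, coeff_mk, Finset.sum_range_one, if_true, zero_add, Nat.succ_ne_zero, if_false]
    rw [← ENNReal.ofReal_tsum_of_nonneg (fun n => hf _) hfs']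
    simpa using hf1
  have hfin : rootSum U ≠ ∞ := rootSum_ne_top_of_renewal hU
    (by rw [← coeff_zero_eq_constantCoeff_apply]; simp [hF])
    (rootSum_mk_ofReal_ne_top hw hws) hFs hF1
  have : ∀ n, √(u n) = ((coeff n U) ^ (1 / 2 : ℝ)).toReal := fun n => by
    rw [coeff_mk, ENNReal.ofReal_rpow_of_nonneg (hu n) (by norm_num), Real.sqrt_eq_rpow,
      ENNReal.toReal_ofReal (Real.rpow_nonneg (hu n) _)]
  simp_rw [this]
  exact ENNReal.summable_toReal hfin

end RootSum

/-! ### Second moments of the impulse response to random shocks -/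

/-- Independent identically distributed square integrable random variables. -/
structure IsIIDSquareIntegrable {Ω : Type*} [MeasurableSpace Ω] (P : Measure Ω)
    (ξ : ℤ → Ω → ℝ) : Prop where
  measurable : ∀ k, Measurable (ξ k)
  indep : iIndepFun ξ P
  identDistrib : ∀ k, IdentDistrib (ξ k) (ξ 0) P P
  memLp_zero : MemLp (ξ 0) 2 P

/-- The σ-algebra generated by the shocks strictly before time `t`. -/
abbrev past {Ω : Type*} (ξ : ℤ → Ω → ℝ) (t : ℤ) : MeasurableSpace Ω :=
  ⨆ i ∈ Set.Iio t, MeasurableSpace.comap (ξ i) inferInstance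

theorem past_mono {Ω : Type*} (ξ : ℤ → Ω → ℝ) {s t : ℤ} (h : s ≤ t) : past ξ s ≤ past ξ t :=
  biSup_mono fun _ hi => lt_of_lt_of_le hi h

theorem measurable_past {Ω : Type*} (ξ : ℤ → Ω → ℝ) {s t : ℤ} (h : s < t) :
    Measurable[past ξ t] (ξ s) :=
  (comap_measurable (ξ s)).mono (le_iSup₂_of_le (f := fun i (_ : i ∈ Set.Iio t) =>
    MeasurableSpace.comap (ξ i) inferInstance) s h le_rfl) le_rfl

theorem measurable_propagator {Ω : Type*} (ξ : ℤ → Ω → ℝ) (b : ℕ → ℝ) (s : ℤ) (n : ℕ) :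
    Measurable[past ξ (s + n)] fun ω => propagator b (fun j => ξ (s + j) ω) n := by
  induction n using Nat.strong_induction_on with
  | _ n ih =>
    simp_rw [propagator_eq b _ n]
    refine Measurable.add measurable_const (Finset.measurable_fun_sum _ fun j hj => ?_)
    have hj : j < n := Finset.mem_range.1 hj
    refine measurable_const.mul (Measurable.mul (measurable_past ξ (by omega)) ?_)
    exact (ih j hj).mono (past_mono ξ (by omega)) le_rfl

namespace IsIIDSquareIntegrable

variable {Ω : Type*} [mΩ : MeasurableSpace Ω] {P : Measure Ω} {ξ : ℤ → Ω → ℝ}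

theorem past_le (h : IsIIDSquareIntegrable P ξ) (t : ℤ) : past ξ t ≤ mΩ :=
  iSup₂_le fun i _ => (h.measurable i).comap_le

theorem memLp (h : IsIIDSquareIntegrable P ξ) (k : ℤ) : MemLp (ξ k) 2 P := (h.identDistrib k).memLp_iff.2 h.memLp_zero

theorem integral_eq (h : IsIIDSquareIntegrable P ξ) (k : ℤ) : ∫ ω, ξ k ω ∂P = shockMean P ξ := (h.identDistrib k).integral_eq

theorem integral_sq_sub (h : IsIIDSquareIntegrable P ξ) (k : ℤ) :
    ∫ ω, (ξ k ω - shockMean P ξ) ^ 2 ∂P = shockStd P ξ ^ 2 := by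
  rw [shockStd, Real.sq_sqrt (variance_nonneg _ _), ← (h.identDistrib k).variance_eq,
    variance_eq_integral (h.measurable k).aemeasurable, h.integral_eq]

theorem indepFun_past (h : IsIIDSquareIntegrable P ξ) {t : ℤ} {W : Ω → ℝ} (hW : Measurable[past ξ t] W) {g : ℝ → ℝ}
    (hg : Measurable g) : IndepFun W (fun ω => g (ξ t ω)) P := by
  have hind : Indep (past ξ t) (⨆ i ∈ ({t} : Set ℤ), MeasurableSpace.comap (ξ i) inferInstance) P :=
    indep_iSup_of_disjoint (fun i => (h.measurable i).comap_le) h.indep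
      (Set.disjoint_singleton_right.2 (by simp))
  rw [_root_.iSup_singleton] at hind
  exact indep_of_indep_of_le_left (indep_of_indep_of_le_right hind
    (Measurable.comap_le (hg.comp (comap_measurable (ξ t))))) hW.comap_le

theorem integral_mul (h : IsIIDSquareIntegrable P ξ) {t : ℤ} {W : Ω → ℝ} (hW : Measurable[past ξ t] W) {g : ℝ → ℝ}
    (hg : Measurable g) :
    ∫ ω, W ω * g (ξ t ω) ∂P = (∫ ω, W ω ∂P) * ∫ ω, g (ξ t ω) ∂P :=
  (h.indepFun_past hW hg).integral_mul_eq_mul_integral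
    (hW.mono (h.past_le t) le_rfl).aestronglyMeasurable
    (hg.comp (h.measurable t)).aestronglyMeasurable

theorem memLp_mul (h : IsIIDSquareIntegrable P ξ) {t : ℤ} {W : Ω → ℝ} (hW : Measurable[past ξ t] W) (hW2 : MemLp W 2 P)
    {g : ℝ → ℝ} (hg : Measurable g) (hg2 : MemLp (fun ω => g (ξ t ω)) 2 P) :
    MemLp (fun ω => g (ξ t ω) * W ω) 2 P := by
  have hWm := hW.mono (h.past_le t) le_rfl
  have hgm := hg.comp (h.measurable t)
  refine (memLp_two_iff_integrable_sq (hgm.mul hWm).aestronglyMeasurable).2 ?_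
  have := (h.indepFun_past (hW.pow_const 2) (hg.pow_const 2)).integrable_mul
    hW2.integrable_sq hg2.integrable_sq
  refine this.congr (Filter.Eventually.of_forall fun ω => ?_)
  simp only [Pi.mul_apply, Function.comp_apply]
  ring

variable (b : ℕ → ℝ)

theorem memLp_propagator [IsProbabilityMeasure P] (h : IsIIDSquareIntegrable P ξ)
    (s : ℤ) (n : ℕ) :
    MemLp (fun ω => propagator b (fun j => ξ (s + j) ω) n) 2 P := by
  induction n using Nat.strong_induction_on with
  | _ n ih =>
    simp_rw [propagator_eq b _ n]
    have hsum : MemLp (fun ω => ∑ j ∈ range n, b (n - j) *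
        (ξ (s + j) ω * propagator b (fun j => ξ (s + j) ω) j)) 2 P := by
      refine memLp_finsetSum _ fun j hj => ?_
      have := h.memLp_mul (measurable_propagator ξ b s j) (ih j (Finset.mem_range.1 hj))
        measurable_id (h.memLp _)
      exact this.const_mul (b (n - j))
    exact (memLp_const (if n = 0 then (1 : ℝ) else 0)).add hsum

/-- In the expansion of `propagator_eq_resolvent_add` each `Y j` is a centred shock times a variable
of its strict past. Hence the `Y j` are centred and orthogonal, and only the diagonal terms of the
square survive. -/
theorem integral_propagator_sq [IsProbabilityMeasure P] (h : IsIIDSquareIntegrable P ξ)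
    (hl : shockMean P ξ ≠ 0) (s : ℤ) (n : ℕ) :
    ∫ ω, propagator b (fun j => ξ (s + j) ω) n ^ 2 ∂P =
      resolvent (shockMean P ξ) b n ^ 2 + ∑ j ∈ range n,
        (shockStd P ξ / shockMean P ξ) ^ 2 * resolvent (shockMean P ξ) b (n - j) ^ 2 *
          ∫ ω, propagator b (fun j => ξ (s + j) ω) j ^ 2 ∂P := by
  set l := shockMean P ξ with hl'
  set S : ℕ → Ω → ℝ := fun n ω => propagator b (fun j => ξ (s + j) ω) n with hS
  set Y : ℕ → Ω → ℝ := fun j ω => (ξ (s + j) ω - l) * S j ω with hY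
  have hSm : ∀ j : ℕ, Measurable[past ξ (s + j)] (S j) := measurable_propagator ξ b s
  have hgm : Measurable fun x : ℝ => x - l := measurable_id.sub_const l
  have hYL : ∀ j, MemLp (Y j) 2 P := fun j => h.memLp_mul (hSm j) (h.memLp_propagator b s j)
    hgm ((h.memLp _).sub (memLp_const l))
  have hc0 : ∀ t : ℤ, ∫ ω, (ξ t ω - l) ∂P = 0 := fun t => by
    rw [integral_sub ((h.memLp t).integrable (by norm_num)) (integrable_const l), h.integral_eq]
    simp [hl']
  have hY0 : ∀ j, ∫ ω, Y j ω ∂P = 0 := fun j => by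
    have := h.integral_mul (hSm j) hgm
    rw [hc0, mul_zero] at this
    rw [← this]
    exact integral_congr_ae (Filter.Eventually.of_forall fun ω => mul_comm _ _)
  have hYm : ∀ i j : ℕ, i < j → Measurable[past ξ (s + j)] (Y i) := fun i j hij =>
    Measurable.mul ((measurable_past ξ (by omega)).sub_const l)
      ((hSm i).mono (past_mono ξ (by omega)) le_rfl)
  have hYlt : ∀ i j : ℕ, i < j → ∫ ω, Y i ω * Y j ω ∂P = 0 := fun i j hij => by
    have := h.integral_mul ((hYm i j hij).mul (hSm j)) hgm
    rw [hc0, mul_zero] at this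
    rw [← this]
    refine integral_congr_ae (Filter.Eventually.of_forall fun ω => ?_)
    simp only [hY, Pi.mul_apply]
    ring
  have hYne : ∀ i j : ℕ, i ≠ j → ∫ ω, Y i ω * Y j ω ∂P = 0 := fun i j hij => by
    rcases lt_or_gt_of_ne hij with hij | hij
    · exact hYlt i j hij
    · simp_rw [mul_comm (Y i _)]
      exact hYlt j i hij
  have hYY : ∀ j : ℕ, ∫ ω, Y j ω * Y j ω ∂P = shockStd P ξ ^ 2 * ∫ ω, S j ω ^ 2 ∂P := fun j => by
    have := h.integral_mul (t := s + j) ((hSm j).pow_const 2) (hgm.pow_const 2)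
    rw [h.integral_sq_sub, mul_comm] at this
    rw [← this]
    refine integral_congr_ae (Filter.Eventually.of_forall fun ω => ?_)
    simp only [hY]
    ring
  set c : ℕ → ℝ := fun j => l⁻¹ * resolvent l b (n - j) with hc
  have hexp : ∀ ω, S n ω ^ 2 = resolvent l b n ^ 2 +
      ∑ j ∈ range n, 2 * resolvent l b n * c j * Y j ω +
      ∑ i ∈ range n, ∑ j ∈ range n, c i * c j * (Y i ω * Y j ω) := fun ω => by
    have : S n ω = resolvent l b n + ∑ j ∈ range n, c j * Y j ω :=
      propagator_eq_resolvent_add l b hl _ n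
    have e2 : ∑ i ∈ range n, ∑ j ∈ range n, c i * c j * (Y i ω * Y j ω) =
        (∑ j ∈ range n, c j * Y j ω) * ∑ j ∈ range n, c j * Y j ω := by
      rw [Finset.sum_mul_sum]
      exact Finset.sum_congr rfl fun i _ => Finset.sum_congr rfl fun j _ => by ring
    have e1 : ∑ j ∈ range n, 2 * resolvent l b n * c j * Y j ω =
        2 * resolvent l b n * ∑ j ∈ range n, c j * Y j ω := by
      rw [Finset.mul_sum]
      exact Finset.sum_congr rfl fun i _ => by ring
    rw [this, e1, e2]
    ring
  have hi1 : ∀ j, Integrable (fun ω => 2 * resolvent l b n * c j * Y j ω) P := fun j =>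
    ((hYL j).integrable (by norm_num)).const_mul _
  have hi2 : ∀ i j, Integrable (fun ω => c i * c j * (Y i ω * Y j ω)) P := fun i j =>
    ((hYL i).integrable_mul (hYL j)).const_mul _
  have hI1 : Integrable (fun ω => ∑ j ∈ range n, 2 * resolvent l b n * c j * Y j ω) P :=
    integrable_finsetSum _ fun j _ => hi1 j
  have hI2 : ∀ i, Integrable (fun ω => ∑ j ∈ range n, c i * c j * (Y i ω * Y j ω)) P := fun i =>
    integrable_finsetSum _ fun j _ => hi2 i j
  have hI3 : Integrable (fun ω => ∑ i ∈ range n, ∑ j ∈ range n, c i * c j * (Y i ω * Y j ω)) P :=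
    integrable_finsetSum _ fun i _ => hI2 i
  have hI4 : Integrable (fun ω => resolvent l b n ^ 2 +
      ∑ j ∈ range n, 2 * resolvent l b n * c j * Y j ω) P := (integrable_const _).add hI1
  rw [show ∫ ω, propagator b (fun j => ξ (s + j) ω) n ^ 2 ∂P = _ from
      integral_congr_ae (Filter.Eventually.of_forall hexp),
    integral_add hI4 hI3, integral_add (integrable_const _) hI1,
    integral_finsetSum _ fun j _ => hi1 j, integral_finsetSum _ fun i _ => hI2 i]
  simp_rw [integral_const_mul, hY0]
  rw [Finset.sum_congr rfl fun i hi => (integral_finsetSum (range n) fun j _ => hi2 i j).trans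
    (Finset.sum_eq_single i (fun j _ hji => by rw [integral_const_mul, hYne i j hji.symm, mul_zero])
      fun hni => absurd hi hni)]
  simp only [mul_zero, Finset.sum_const_zero, add_zero, integral_const, probReal_univ, one_smul]
  congr 1
  refine Finset.sum_congr rfl fun j _ => ?_
  rw [integral_const_mul, hYY, hc]
  simp only [hS]
  field_simp

/-- The coefficients of the renewal equation do not involve `s`. -/
theorem integral_propagator_sq_eq_zero_start [IsProbabilityMeasure P] (h : IsIIDSquareIntegrable P ξ)
    (hl : shockMean P ξ ≠ 0) (s : ℤ) (n : ℕ) :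
    ∫ ω, propagator b (fun j => ξ (s + j) ω) n ^ 2 ∂P =
      ∫ ω, propagator b (fun j => ξ (0 + j) ω) n ^ 2 ∂P := by
  induction n using Nat.strong_induction_on with
  | _ n ih =>
    rw [h.integral_propagator_sq b hl, h.integral_propagator_sq b hl]
    congr 1
    exact Finset.sum_congr rfl fun j hj => by rw [ih j (Finset.mem_range.1 hj)]

variable {b}

theorem summable_sqrt_integral_propagator_sq [IsProbabilityMeasure P] (h : IsIIDSquareIntegrable P ξ)
    (hl : 0 < shockMean P ξ)
    (hb : ∀ j, 1 ≤ j → 0 ≤ b j) (h1 : CondS1 (shockMean P ξ) b)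
    (h2 : CondS2 (shockMean P ξ) (shockStd P ξ) b) (s : ℤ) :
    Summable fun n => √(∫ ω, propagator b (fun j => ξ (s + j) ω) n ^ 2 ∂P) := by
  have hz := resolvent_nonneg hl.le hb
  have hσ : 0 ≤ shockStd P ξ := Real.sqrt_nonneg _
  have hzs := summable_resolvent hl.le hb h1
  have hr : 0 ≤ shockStd P ξ / shockMean P ξ := div_nonneg hσ hl.le
  refine summable_sqrt_of_renewal (w := fun n => resolvent (shockMean P ξ) b n ^ 2)
    (f := fun n => (shockStd P ξ / shockMean P ξ) ^ 2 * resolvent (shockMean P ξ) b n ^ 2)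
    (fun n => integral_nonneg fun ω => sq_nonneg _) (fun n => sq_nonneg _)
    (fun n => by positivity) (fun n => h.integral_propagator_sq b hl.ne' s n) ?_ ?_
    (h2.1.mul_left _) ?_
  · simpa only [Real.sqrt_sq (hz _)] using hzs
  · simp_rw [← mul_pow, Real.sqrt_sq (mul_nonneg hr (hz _))]
    exact ((summable_nat_add_iff 1).2 hzs).mul_left _
  · rw [tsum_mul_left]
    have hT : 0 ≤ ∑' j : ℕ, resolvent (shockMean P ξ) b (j + 1) ^ 2 :=
      tsum_nonneg fun _ => sq_nonneg _
    have := h2.2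
    rw [← Real.sq_sqrt hT, ← mul_pow]
    exact pow_lt_one₀ (mul_nonneg hr (Real.sqrt_nonneg _)) this (by norm_num)

end IsIIDSquareIntegrable

/-! ### Causality of square integrable solutions -/

/-- Solution of a triangular linear recursion in terms of the propagator. -/
theorem eq_sum_propagator {b x h y : ℕ → ℝ} {N : ℕ}
    (heq : ∀ n ≤ N, y n = x n * (h n + ∑ j ∈ range n, b (n - j) * y j)) {n : ℕ} (hn : n ≤ N) :
    y n = ∑ i ∈ range (n + 1), x n * propagator b (fun j => x (i + j)) (n - i) * h i := by
  induction n using Nat.strong_induction_on with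
  | _ n ih =>
    have e1 : ∑ j ∈ range n, b (n - j) * y j = ∑ i ∈ range n,
        ∑ j ∈ Ico i n, b (n - j) * (x j * propagator b (fun k => x (i + k)) (j - i)) * h i := by
      calc _ = ∑ j ∈ range n, ∑ i ∈ range (j + 1),
            b (n - j) * (x j * propagator b (fun k => x (i + k)) (j - i)) * h i := by
            refine Finset.sum_congr rfl fun j hj => ?_
            have hj := Finset.mem_range.1 hj
            rw [ih j hj (by omega), Finset.mul_sum]
            exact Finset.sum_congr rfl fun i _ => by ring
        _ = _ := by
            refine Finset.sum_comm' fun j i => ?_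
            simp only [mem_range, mem_Ico]; omega
    have e2 : ∀ i ∈ range n,
        ∑ j ∈ Ico i n, b (n - j) * (x j * propagator b (fun k => x (i + k)) (j - i)) * h i =
          propagator b (fun k => x (i + k)) (n - i) * h i := fun i hi => by
      have hi := Finset.mem_range.1 hi
      rw [propagator_eq b _ (n - i), if_neg (by omega), zero_add, ← Finset.sum_mul,
        Finset.sum_Ico_eq_sum_range]
      congr 1
      refine Finset.sum_congr rfl fun j _ => ?_
      rw [Nat.add_sub_cancel_left, Nat.sub_sub]
    rw [heq n hn, e1, Finset.sum_congr rfl e2, Finset.sum_range_succ, Nat.sub_self,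
      propagator_zero, mul_add, Finset.mul_sum, mul_one, add_comm]
    congr 1
    exact Finset.sum_congr rfl fun i _ => by ring

theorem tendsto_sum_range_mul_nhds_zero {v T : ℕ → ℝ} (hv : ∀ n, 0 ≤ v n) (hvs : Summable v)
    (hT : Filter.Tendsto T Filter.atTop (nhds 0)) :
    Filter.Tendsto (fun n => ∑ i ∈ range (n + 1), v (n - i) * T i) Filter.atTop (nhds 0) := by
  obtain ⟨K, hK⟩ := (Metric.isBounded_range_of_tendsto T hT).exists_norm_le
  have hK : ∀ n, ‖T n‖ ≤ K := fun n => hK _ ⟨n, rfl⟩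
  have hK0 : 0 ≤ K := (norm_nonneg _).trans (hK 0)
  have key := tendsto_tsum_of_dominated_convergence
    (f := fun n k => if k ≤ n then v k * T (n - k) else 0) (g := fun _ => (0 : ℝ))
    (𝓕 := Filter.atTop) (hvs.mul_right K) (fun k => by
      have h1 : Filter.Tendsto (fun n => v k * T (n - k)) Filter.atTop (nhds (v k * 0)) :=
        (hT.comp (Filter.tendsto_sub_atTop_nat k)).const_mul _
      rw [mul_zero] at h1
      refine h1.congr' ?_
      filter_upwards [Filter.eventually_ge_atTop k] with n hn
      rw [if_pos hn])
    (Filter.Eventually.of_forall fun n k => by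
      split_ifs
      · rw [norm_mul, Real.norm_of_nonneg (hv k)]
        exact mul_le_mul_of_nonneg_left (hK _) (hv k)
      · rw [norm_zero]; exact mul_nonneg (hv k) hK0)
  rw [tsum_zero] at key
  refine key.congr fun n => ?_
  rw [tsum_eq_sum (s := range (n + 1)) fun k hk => if_neg (by
    rw [Finset.mem_range] at hk; omega), ← Finset.sum_range_reflect]
  refine Finset.sum_congr rfl fun i hi => ?_
  have := Finset.mem_range.1 hi
  rw [if_pos (by omega)]
  rw [Nat.add_sub_cancel, Nat.sub_sub_self (by omega)]

section Modification

variable {Ω : Type*} {m m₀ : MeasurableSpace Ω} {P : Measure Ω}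

/-- An `L¹`-limit of `m`-measurable functions has an `m`-measurable version. -/
theorem exists_measurable_of_tendsto_eLpNorm [IsProbabilityMeasure P] (hm : m ≤ m₀) {f : Ω → ℝ} {U : ℕ → Ω → ℝ}
    (hf : Integrable f P) (hU : ∀ n, Measurable[m] (U n)) (hUi : ∀ n, Integrable (U n) P)
    (hlim : Filter.Tendsto (fun n => eLpNorm (f - U n) 1 P) Filter.atTop (nhds 0)) :
    ∃ g : Ω → ℝ, Measurable[m] g ∧ f =ᵐ[P] g := by
  -- As `E[U n | m] = U n`, `f - E[f | m]` equals `(f - U n) - E[f - U n | m]`; conditional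
  -- expectation contracts `L¹`.
  refine ⟨P[f|m], stronglyMeasurable_condExp.measurable, ?_⟩
  have hle : ∀ n, eLpNorm (f - P[f|m]) 1 P ≤ eLpNorm (f - U n) 1 P + eLpNorm (f - U n) 1 P := by
    intro n
    have h1 : f - P[f|m] =ᵐ[P] (f - U n) - P[f - U n|m] := by
      filter_upwards [condExp_sub hf (hUi n) m] with ω hω
      rw [Pi.sub_apply, Pi.sub_apply, hω, Pi.sub_apply, Pi.sub_apply,
        condExp_of_stronglyMeasurable hm (hU n).stronglyMeasurable (hUi n)]
      ring
    rw [eLpNorm_congr_ae h1]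
    exact (eLpNorm_sub_le (hf.sub (hUi n)).aestronglyMeasurable
      integrable_condExp.aestronglyMeasurable le_rfl).trans
      (add_le_add le_rfl (eLpNorm_condExp_le_eLpNorm _ le_rfl))
  have h0 : eLpNorm (f - P[f|m]) 1 P = 0 := by
    have := ge_of_tendsto' (hlim.add hlim) hle
    simpa using this
  rw [eLpNorm_eq_zero_iff (hf.sub integrable_condExp).aestronglyMeasurable one_ne_zero] at h0
  filter_upwards [h0] with ω hω
  exact sub_eq_zero.1 hω

theorem exists_measurable_tsum {F : ℕ → Ω → ℝ}
    (hF : ∀ j, ∃ g : Ω → ℝ, Measurable[m] g ∧ F j =ᵐ[P] g) :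
    ∃ g : Ω → ℝ, Measurable[m] g ∧ (fun ω => ∑' j, F j ω) =ᵐ[P] g := by
  choose g hg hFg using hF
  refine ⟨fun ω => ∑' j, g j ω, @Measurable.tsum Ω ℝ ℕ m _ _ _ _ _ _ _ _ _ _ _ _ hg, ?_⟩
  filter_upwards [ae_all_iff.2 hFg] with ω hω
  exact tsum_congr hω

end Modification

theorem MemLp.eLpNorm_two_eq {Ω : Type*} [MeasurableSpace Ω] {P : Measure Ω} {f : Ω → ℝ}
    (hf : MemLp f 2 P) : eLpNorm f 2 P = ENNReal.ofReal (√(∫ ω, f ω ^ 2 ∂P)) := by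
  rw [hf.eLpNorm_eq_integral_rpow_norm (by norm_num) (by norm_num), Real.sqrt_eq_rpow]
  simp

variable {Ω : Type*} [mΩ : MeasurableSpace Ω] {P : Measure Ω}
  {a : ℝ} {b : ℕ → ℝ} {ξ X : ℤ → Ω → ℝ}

theorem IsSolution.isIIDSquareIntegrable (hX : IsSolution P a b ξ X) (hL : MemLp (ξ 0) 2 P) :
    IsIIDSquareIntegrable P ξ :=
  ⟨hX.shock_measurable, hX.shock_indep, hX.shock_identDistrib, hL⟩

theorem IsIIDSquareIntegrable.memLp_mul_propagator [IsProbabilityMeasure P]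
    (h : IsIIDSquareIntegrable P ξ) (s : ℤ)
    (n : ℕ) :
    MemLp (fun ω => ξ (s + n) ω * propagator b (fun j => ξ (s + j) ω) n) 2 P :=
  h.memLp_mul (measurable_propagator ξ b s n) (h.memLp_propagator b s n) measurable_id (h.memLp _)

theorem IsIIDSquareIntegrable.eLpNorm_mul_propagator [IsProbabilityMeasure P]
    (h : IsIIDSquareIntegrable P ξ)
    (hl : shockMean P ξ ≠ 0) (s : ℤ) (n : ℕ) :
    eLpNorm (fun ω => ξ (s + n) ω * propagator b (fun j => ξ (s + j) ω) n) 2 P =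
      ENNReal.ofReal (√(∫ ω, propagator b (fun j => ξ (0 + j) ω) n ^ 2 ∂P) *
        √(∫ ω, ξ 0 ω ^ 2 ∂P)) := by
  rw [MemLp.eLpNorm_two_eq (h.memLp_mul_propagator s n),
    ← Real.sqrt_mul (integral_nonneg fun _ => sq_nonneg _),
    ← h.integral_propagator_sq_eq_zero_start b hl s n]
  have h1 := h.integral_mul (t := s + n) ((measurable_propagator ξ b s n).pow_const 2)
    (measurable_id.pow_const 2)
  have h2 : ∫ ω, ξ (s + n) ω ^ 2 ∂P = ∫ ω, ξ 0 ω ^ 2 ∂P :=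
    ((h.identDistrib (s + n)).comp (measurable_id.pow_const 2)).integral_eq
  rw [← h2]
  simp only [id] at h1
  rw [← h1]
  congr 2
  exact integral_congr_ae (Filter.Eventually.of_forall fun ω => by ring)

/-- Hölder termwise, then Tonelli; no independence of `G` from the `F j` is needed, which matters
because causality is not yet known. -/
theorem eLpNorm_mul_tsum_le {G : Ω → ℝ} {F : ℕ → Ω → ℝ} {β : ℕ → ℝ} {v M : ℝ}
    (hG : AEStronglyMeasurable G P) (hF : ∀ j, AEStronglyMeasurable (F j) P)
    (hGv : eLpNorm G 2 P ≤ ENNReal.ofReal v) (hv : 0 ≤ v)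
    (hFM : ∀ j, eLpNorm (F j) 2 P ≤ ENNReal.ofReal M)
    (hβ : ∀ j, 0 ≤ β j) (hβs : Summable β) :
    eLpNorm (fun ω => G ω * ∑' j, β j * F j ω) 1 P ≤
      ENNReal.ofReal (v * (∑' j, β j) * M) := by
  have h1 : ∀ j, eLpNorm (fun ω => G ω * F j ω) 1 P ≤ ENNReal.ofReal (v * M) := fun j => by
    rw [ENNReal.ofReal_mul hv]
    exact (eLpNorm_smul_le_mul_eLpNorm (p := 2) (q := 2) (r := 1) (hF j) hG).trans
      (mul_le_mul' hGv (hFM j))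
  calc eLpNorm (fun ω => G ω * ∑' j, β j * F j ω) 1 P
      = ∫⁻ ω, ‖G ω * ∑' j, β j * F j ω‖ₑ ∂P := eLpNorm_one_eq_lintegral_enorm
    _ ≤ ∫⁻ ω, ∑' j, ENNReal.ofReal (β j) * ‖G ω * F j ω‖ₑ ∂P := by
        refine lintegral_mono fun ω => ?_
        rw [← tsum_mul_left]
        refine enorm_tsum_le_tsum_enorm.trans (ENNReal.tsum_le_tsum fun j => le_of_eq ?_)
        rw [mul_left_comm, enorm_mul, Real.enorm_of_nonneg (hβ j)]
    _ = ∑' j, ENNReal.ofReal (β j) * eLpNorm (fun ω => G ω * F j ω) 1 P := by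
        have hGF : ∀ j, AEMeasurable (fun ω => ‖G ω * F j ω‖ₑ) P := fun j =>
          (hG.mul (hF j)).enorm
        rw [lintegral_tsum fun j => (hGF j).const_mul _]
        refine tsum_congr fun j => ?_
        rw [lintegral_const_mul'' _ (hGF j), eLpNorm_one_eq_lintegral_enorm]
    _ ≤ ∑' j, ENNReal.ofReal (β j) * ENNReal.ofReal (v * M) :=
        ENNReal.tsum_le_tsum fun j => mul_le_mul' le_rfl (h1 j)
    _ = _ := by
        rw [ENNReal.tsum_mul_right, ← ENNReal.ofReal_tsum_of_nonneg hβ hβs,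
          ← ENNReal.ofReal_mul (tsum_nonneg hβ)]
        congr 1
        ring

namespace IsSolution

/-- Expansion of a solution started at time `s`, with the values before `s` as inputs. -/
theorem ae_eq_sum_propagator (hX : IsSolution P a b ξ X) (s : ℤ) (n : ℕ) :
    ∀ᵐ ω ∂P, X (s + n) ω = ∑ i ∈ range (n + 1),
      ξ (s + n) ω * propagator b (fun j => ξ (s + i + j) ω) (n - i) *
        (a + ∑' j : ℕ, b (j + i + 1) * X (s - 1 - j) ω) := by
  filter_upwards [ae_all_iff.2 hX.summable, ae_all_iff.2 hX.equation] with ω hs he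
  have key := eq_sum_propagator (b := b) (x := fun n => ξ (s + n) ω) (y := fun n => X (s + n) ω)
    (h := fun i => a + ∑' j : ℕ, b (j + i + 1) * X (s - 1 - j) ω) (N := n) (fun m _ => ?_) le_rfl
  · rw [key]
    refine Finset.sum_congr rfl fun i _ => ?_
    congr 3
    ext j
    push_cast
    rw [add_assoc]
  -- The first `m` terms of the volatility series refer to times from `s` on, the rest to times
  -- before `s`.
  · rw [he (s + m), mul_comm, volatility, ← (hs (s + m)).sum_add_tsum_nat_add m, add_assoc,
      add_comm (∑' j : ℕ, _) (∑ j ∈ range m, _)]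
    congr 3
    · rw [← Finset.sum_range_reflect]
      refine Finset.sum_congr rfl fun j hj => ?_
      have hj := Finset.mem_range.1 hj
      congr 2
      · omega
      · omega
    · refine tsum_congr fun j => ?_
      congr 2
      push_cast
      ring

theorem exists_measurable_past [IsProbabilityMeasure P]
    (hX : IsSolution P a b ξ X) (hS0 : Standing P a b ξ)
    (hS1 : CondS1 (shockMean P ξ) b) (hS2 : CondS2 (shockMean P ξ) (shockStd P ξ) b)
    (hXL : ∀ k, MemLp (X k) 2 P) {M : ℝ} (hM : 0 ≤ M)
    (hXM : ∀ k, eLpNorm (X k) 2 P ≤ ENNReal.ofReal M) (t : ℤ) :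
    ∃ g : Ω → ℝ, Measurable[past ξ (t + 1)] g ∧ X t =ᵐ[P] g := by
  have h := hX.isIIDSquareIntegrable hS0.memLp
  set v : ℕ → ℝ := fun n => √(∫ ω, propagator b (fun j => ξ (0 + j) ω) n ^ 2 ∂P) *
    √(∫ ω, ξ 0 ω ^ 2 ∂P) with hv
  have hv0 : ∀ n, 0 ≤ v n := fun n => by positivity
  have hvs : Summable v := (h.summable_sqrt_integral_propagator_sq hS0.mean_pos hX.b_nonneg hS1
    hS2 0).mul_right _
  set T : ℕ → ℝ := fun i => ∑' j : ℕ, b (j + i + 1) with hT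
  have hT0 : Filter.Tendsto T Filter.atTop (nhds 0) := tendsto_sum_nat_add fun j => b (j + 1)
  set G : ℕ → ℕ → Ω → ℝ := fun n i ω =>
    ξ t ω * propagator b (fun j => ξ (t - n + i + j) ω) (n - i) with hG
  have hGeq : ∀ n i, i ≤ n → G n i = fun ω => ξ (t - n + i + (n - i : ℕ)) ω *
      propagator b (fun j => ξ (t - n + i + j) ω) (n - i) := fun n i hi => by
    have : t - n + i + (n - i : ℕ) = t := by omega
    rw [this]
  have hGL : ∀ n i, i ≤ n → MemLp (G n i) 2 P := fun n i hi => by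
    rw [hGeq n i hi]
    exact h.memLp_mul_propagator _ _
  have hGv : ∀ n i, i ≤ n → eLpNorm (G n i) 2 P ≤ ENNReal.ofReal (v (n - i)) := fun n i hi => by
    rw [hGeq n i hi, h.eLpNorm_mul_propagator hS0.mean_pos.ne']
  have hGm : ∀ n i, i ≤ n → Measurable[past ξ (t + 1)] (G n i) := fun n i hi =>
    (measurable_past ξ (by omega)).mul
      ((measurable_propagator ξ b (t - n + i) (n - i)).mono (past_mono ξ (by omega)) le_rfl)
  -- The approximants keep only the input `a` and drop the values of `X` before `t - n`.
  refine exists_measurable_of_tendsto_eLpNorm (h.past_le _)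
    (U := fun n ω => ∑ i ∈ range (n + 1), G n i ω * a) ((hXL t).integrable (by norm_num))
    (fun n => Finset.measurable_fun_sum _ fun i hi =>
      (hGm n i (by have := Finset.mem_range.1 hi; omega)).mul_const a)
    (fun n => integrable_finsetSum _ fun i hi =>
      ((hGL n i (by have := Finset.mem_range.1 hi; omega)).integrable (by norm_num)).mul_const a) ?_
  have hle : ∀ n, eLpNorm (X t - fun ω => ∑ i ∈ range (n + 1), G n i ω * a) 1 P ≤
      ENNReal.ofReal ((∑ i ∈ range (n + 1), v (n - i) * T i) * M) := by
    intro n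
    set D : ℕ → Ω → ℝ := fun i ω => G n i ω * ∑' j : ℕ, b (j + i + 1) * X (t - n - 1 - j) ω with hD
    have hae : (X t - fun ω => ∑ i ∈ range (n + 1), G n i ω * a) =ᵐ[P]
        ∑ i ∈ range (n + 1), D i := by
      have := hX.ae_eq_sum_propagator (t - n) n
      rw [sub_add_cancel] at this
      filter_upwards [this] with ω hω
      rw [Pi.sub_apply, hω, ← Finset.sum_sub_distrib, Finset.sum_apply]
      refine Finset.sum_congr rfl fun i _ => ?_
      simp only [hG, hD]
      ring
    have hDm : ∀ i ≤ n, AEStronglyMeasurable (D i) P := fun i hi => by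
      obtain ⟨g, hg, hDg⟩ := exists_measurable_tsum (m := mΩ)
        (F := fun j ω => b (j + i + 1) * X (t - n - 1 - j) ω) (fun j =>
          ⟨fun ω => b (j + i + 1) * (hXL (t - n - 1 - j)).aestronglyMeasurable.mk _ ω,
            ((hXL (t - n - 1 - j)).aestronglyMeasurable.stronglyMeasurable_mk.measurable).const_mul
              _, by
            filter_upwards [(hXL (t - n - 1 - j)).aestronglyMeasurable.ae_eq_mk] with ω hω
            rw [hω]⟩)
      exact (hGL n i hi).aestronglyMeasurable.mul ⟨g, hg.stronglyMeasurable, hDg⟩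
    rw [eLpNorm_congr_ae hae, Finset.sum_mul, ENNReal.ofReal_sum_of_nonneg fun i _ =>
      mul_nonneg (mul_nonneg (hv0 _) (tsum_nonneg fun j => hX.b_nonneg _ (by omega))) hM]
    refine (eLpNorm_sum_le (fun i hi => hDm i (by have := Finset.mem_range.1 hi; omega))
      le_rfl).trans (Finset.sum_le_sum fun i hi => ?_)
    have hi : i ≤ n := by have := Finset.mem_range.1 hi; omega
    exact eLpNorm_mul_tsum_le (hGL n i hi).aestronglyMeasurable
      (fun j => (hXL _).aestronglyMeasurable) (hGv n i hi) (hv0 _) (fun j => hXM _)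
      (fun j => hX.b_nonneg _ (by omega)) ((summable_nat_add_iff i).2 hS1.1)
  have hlim := (tendsto_sum_range_mul_nhds_zero hv0 hvs hT0).mul_const M
  rw [zero_mul] at hlim
  have hlim := ENNReal.tendsto_ofReal hlim
  rw [ENNReal.ofReal_zero] at hlim
  exact tendsto_of_tendsto_of_tendsto_of_le_of_le tendsto_const_nhds hlim (fun _ => zero_le) hle

end IsSolution

theorem exists_measurable_past_volatility
    (hc : ∀ t, ∃ g : Ω → ℝ, Measurable[past ξ (t + 1)] g ∧ X t =ᵐ[P] g) (t : ℤ) :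
    ∃ g : Ω → ℝ, Measurable[past ξ t] g ∧ volatility a b X t =ᵐ[P] g := by
  obtain ⟨g, hg, hge⟩ := exists_measurable_tsum (m := past ξ t) (fun j => by
    obtain ⟨g, hg, hge⟩ := hc (t - ((j : ℤ) + 1))
    refine ⟨fun ω => b (j + 1) * g ω, (hg.mono (past_mono ξ (by omega)) le_rfl).const_mul _, ?_⟩
    filter_upwards [hge] with ω hω
    rw [← hω])
  refine ⟨fun ω => a + g ω, hg.const_add a, ?_⟩
  filter_upwards [hge] with ω hω
  rw [volatility, ← hω]

/-! ### Deterministic consequences of the Yule–Walker equations -/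

section YuleWalker

variable {l : ℝ} {b : ℕ → ℝ} {r : ℤ → ℝ} {K : ℝ}

/-- Each use of the equations improves a lower bound on all of `ℤ` by the factor `c < 1`; evenness
covers `k < 0`, where they are not available. -/
theorem nonneg_of_yuleWalker (hl : 0 ≤ l) (hb : ∀ j, 1 ≤ j → 0 ≤ b j) (h1 : CondS1 l b)
    (heven : ∀ k, r (-k) = r k) (hK : ∀ k, |r k| ≤ K) (h0 : 0 ≤ r 0)
    (hr : ∀ k : ℤ, 1 ≤ k → HasSum (fun j : ℕ => b (j + 1) * r (k - ((j : ℤ) + 1))) (r k / l))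
    (hl0 : l ≠ 0) (k : ℤ) : 0 ≤ r k := by
  obtain ⟨hs, hc1⟩ := h1
  set c := l * ∑' j : ℕ, b (j + 1) with hc
  have hc0 : 0 ≤ c := mul_nonneg hl (tsum_nonneg fun j => hb _ (by omega))
  have hK0 : 0 ≤ K := (abs_nonneg _).trans (hK 0)
  have key : ∀ (n : ℕ) (k : ℤ), -(K * c ^ n) ≤ r k := by
    clear k
    intro n
    induction n with
    | zero => intro k; simpa using neg_le_of_abs_le (hK k)
    | succ n ih =>
      have hpos : ∀ k : ℤ, 1 ≤ k → -(K * c ^ (n + 1)) ≤ r k := fun k hk => by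
        have h2 := hasSum_le (fun j : ℕ => mul_le_mul_of_nonneg_left (ih (k - ((j : ℤ) + 1)))
          (hb (j + 1) (by omega))) (hs.hasSum.mul_right _) (hr k hk)
        rw [le_div_iff₀ (lt_of_le_of_ne hl (Ne.symm hl0))] at h2
        refine le_trans (le_of_eq ?_) h2
        rw [hc]; ring
      intro k
      rcases lt_trichotomy k 0 with hk | hk | hk
      · rw [← heven]; exact hpos _ (by omega)
      · rw [hk]
        exact (neg_nonpos.2 (by positivity)).trans h0
      · exact hpos _ (by omega)
  have hlim : Filter.Tendsto (fun n : ℕ => -(K * c ^ n)) Filter.atTop (nhds (-(K * 0))) :=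
    ((tendsto_pow_atTop_nhds_zero_of_lt_one hc0 hc1).const_mul K).neg
  simpa using le_of_tendsto' hlim fun n => key n k

theorem exists_one_lt_mul_tsum_mul_pow_lt_one (hb : ∀ j, 1 ≤ j → 0 ≤ b j) (h1 : CondS1 l b)
    {α C : ℝ} (hα : 0 < α) (hα1 : α < 1) (hC : ∀ k, 1 ≤ k → b k ≤ C * α ^ k) :
    ∃ R : ℝ, 1 < R ∧ Summable (fun j : ℕ => b (j + 1) * R ^ (j + 1)) ∧
      l * ∑' j : ℕ, b (j + 1) * R ^ (j + 1) < 1 := by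
  -- For `R ≤ R₀ < α⁻¹` a geometric series dominates, so the sum is continuous at `R = 1`, where
  -- `(S₁)` holds strictly.
  obtain ⟨R₀, hR₀, hR₀α⟩ := exists_between ((one_lt_inv₀ hα).2 hα1)
  have hR₀0 : 0 ≤ R₀ := by linarith
  have hq : R₀ * α < 1 := by rwa [lt_inv_comm₀ (by linarith) hα, ← one_div,
    lt_div_iff₀ (by linarith), mul_comm] at hR₀α
  have hbs : Summable fun j : ℕ => C * (R₀ * α) ^ (j + 1) :=
    ((summable_nat_add_iff 1).2 (summable_geometric_of_lt_one (by positivity) hq)).mul_left C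
  have hbd : ∀ R : ℝ, 0 ≤ R → R ≤ R₀ → ∀ j : ℕ, ‖b (j + 1) * R ^ (j + 1)‖ ≤
      C * (R₀ * α) ^ (j + 1) := fun R hR hRR j => by
    have hbj := hb (j + 1) (by omega)
    rw [Real.norm_of_nonneg (mul_nonneg hbj (pow_nonneg hR _))]
    calc b (j + 1) * R ^ (j + 1) ≤ b (j + 1) * R₀ ^ (j + 1) := by gcongr
      _ ≤ C * α ^ (j + 1) * R₀ ^ (j + 1) := by
          gcongr
          exact hC _ (by omega)
      _ = _ := by rw [mul_pow]; ring
  have hlim := (tendsto_tsum_of_dominated_convergence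
    (f := fun (R : ℝ) (j : ℕ) => b (j + 1) * R ^ (j + 1)) (𝓕 := nhds 1)
    (g := fun j : ℕ => b (j + 1) * 1 ^ (j + 1)) hbs
    (fun j => (Continuous.tendsto (by fun_prop) (1 : ℝ)))
    (by
      filter_upwards [Ioo_mem_nhds (show (0 : ℝ) < 1 by norm_num) hR₀] with R hR
      exact hbd R hR.1.le hR.2.le)).const_mul l
  simp only [one_pow, mul_one] at hlim
  have hev : ∀ᶠ R in nhdsWithin (1 : ℝ) (Set.Ioi 1), R ∈ Set.Ioo 1 R₀ ∧
      l * ∑' j : ℕ, b (j + 1) * R ^ (j + 1) < 1 :=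
    Filter.Eventually.and (Ioo_mem_nhdsGT hR₀)
      ((hlim.eventually_lt_const h1.2).filter_mono nhdsWithin_le_nhds)
  obtain ⟨R, hR, hR1⟩ := hev.exists
  exact ⟨R, hR.1, hbs.of_norm_bounded (hbd R (by linarith [hR.1]) hR.2.le), hR1⟩

theorem le_mul_inv_pow_of_yuleWalker (hl : 0 < l) (hb : ∀ j, 1 ≤ j → 0 ≤ b j)
    (hK : ∀ k, |r k| ≤ K)
    (hr : ∀ k : ℤ, 1 ≤ k → HasSum (fun j : ℕ => b (j + 1) * r (k - ((j : ℤ) + 1))) (r k / l))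
    {R : ℝ} (hR : 1 < R) (hs : Summable fun j : ℕ => b (j + 1) * R ^ (j + 1))
    (hR1 : l * ∑' j : ℕ, b (j + 1) * R ^ (j + 1) < 1) (n : ℕ) : r n ≤ K * R⁻¹ ^ n := by
  have hK0 : 0 ≤ K := (abs_nonneg _).trans (hK 0)
  have hR0 : 0 < R := by linarith
  rw [inv_pow, ← div_eq_mul_inv, le_div_iff₀ (by positivity)]
  induction n using Nat.strong_induction_on with
  | _ n ih =>
    rcases Nat.eq_zero_or_pos n with hn | hn
    · subst hn
      simpa using (le_abs_self _).trans (hK 0)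
    · have hterm : ∀ j : ℕ, b (j + 1) * r ((n : ℤ) - ((j : ℤ) + 1)) * R ^ n ≤
          b (j + 1) * R ^ (j + 1) * K := fun j => by
        rw [mul_assoc, mul_assoc]
        refine mul_le_mul_of_nonneg_left ?_ (hb _ (by omega))
        -- Nonnegative lags use the induction hypothesis; negative lags use only `|r| ≤ K` and `R ^
        -- n ≤ R ^ (j + 1)`.
        by_cases hj : j + 1 ≤ n
        · have h2 := ih (n - (j + 1)) (by omega)
          have e : ((n - (j + 1) : ℕ) : ℤ) = (n : ℤ) - ((j : ℤ) + 1) := by omega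
          rw [e] at h2
          calc r ((n : ℤ) - ((j : ℤ) + 1)) * R ^ n
              = r ((n : ℤ) - ((j : ℤ) + 1)) * R ^ (n - (j + 1)) * R ^ (j + 1) := by
                rw [mul_assoc, ← pow_add, Nat.sub_add_cancel hj]
            _ ≤ K * R ^ (j + 1) := by gcongr
            _ = _ := mul_comm _ _
        · calc r ((n : ℤ) - ((j : ℤ) + 1)) * R ^ n ≤ K * R ^ n := by
                gcongr
                exact (le_abs_self _).trans (hK _)
            _ ≤ K * R ^ (j + 1) := by
                gcongr
                · exact hR.le
                · omega
            _ = _ := mul_comm _ _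
      have h2 := hasSum_le hterm ((hr n (by omega)).mul_right _) (hs.hasSum.mul_right K)
      rw [div_mul_eq_mul_div, div_le_iff₀ hl] at h2
      calc r n * R ^ n ≤ (l * ∑' j : ℕ, b (j + 1) * R ^ (j + 1)) * K := by linarith
        _ ≤ 1 * K := by gcongr
        _ = K := one_mul K

end YuleWalker

/-! ### Covariances of the solution and the Yule–Walker equations -/

theorem covariance_eq_integral_centred_mul [IsProbabilityMeasure P]
    {Y Z : Ω → ℝ} (hY : MemLp Y 2 P) (hZ : MemLp Z 2 P) :
    covariance Y Z P = ∫ ω, (Y ω - ∫ x, Y x ∂P) * Z ω ∂P := by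
  rw [covariance_eq_sub hY hZ, ← integral_const_mul, ← integral_sub (hY.integrable_mul hZ)
    ((hZ.integrable (by norm_num)).const_mul _)]
  refine integral_congr_ae (Filter.Eventually.of_forall fun ω => ?_)
  simp only [Pi.mul_apply]
  ring

theorem integral_norm_mul_le {Y Z : Ω → ℝ} (hY : MemLp Y 2 P) (hZ : MemLp Z 2 P) :
    ∫ ω, ‖Y ω * Z ω‖ ∂P ≤ ∫ ω, Y ω ^ 2 ∂P + ∫ ω, Z ω ^ 2 ∂P := by
  rw [← integral_add hY.integrable_sq hZ.integrable_sq]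
  refine integral_mono (hY.integrable_mul hZ).norm (hY.integrable_sq.add hZ.integrable_sq)
    fun ω => ?_
  simp only [norm_mul, Real.norm_eq_abs]
  nlinarith [sq_nonneg (|Y ω| - |Z ω|), sq_abs (Y ω), sq_abs (Z ω), sq_nonneg (Y ω),
    sq_nonneg (Z ω)]

namespace IsWeaklyStationary

theorem covariance_eq (h : IsWeaklyStationary P X) (n m : ℤ) :
    covariance (X n) (X m) P = autocovariance P X (m - n) := by
  obtain ⟨ρ, hρ⟩ := h.cov
  have h1 := hρ n (m - n)
  have h2 := hρ 0 (m - n)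
  rw [add_sub_cancel] at h1
  rw [zero_add] at h2
  rw [← h1, h2, autocovariance]

theorem autocovariance_neg [IsProbabilityMeasure P]
    (h : IsWeaklyStationary P X) (k : ℤ) :
    autocovariance P X (-k) = autocovariance P X k := by
  rw [← zero_sub, ← h.covariance_eq k 0, covariance_comm, autocovariance]

theorem integral_sq_eq [IsProbabilityMeasure P]
    (h : IsWeaklyStationary P X) (k : ℤ) :
    ∫ ω, X k ω ^ 2 ∂P = ∫ ω, X 0 ω ^ 2 ∂P := by
  have e : ∀ k, ∫ ω, X k ω ^ 2 ∂P = autocovariance P X 0 + (∫ ω, X 0 ω ∂P) ^ 2 := fun k => by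
    have h1 := h.covariance_eq k k
    rw [sub_self, covariance_eq_sub (h.memLp k) (h.memLp k), h.mean k] at h1
    rw [← h1, sq (∫ ω, X 0 ω ∂P), sub_add_cancel]
    refine integral_congr_ae (Filter.Eventually.of_forall fun ω => ?_)
    simp only [Pi.mul_apply, sq]
  rw [e, e 0]

theorem integral_norm_centred_mul_le [IsProbabilityMeasure P]
    (h : IsWeaklyStationary P X) (k : ℤ) :
    ∫ ω, ‖(X 0 ω - ∫ x, X 0 x ∂P) * X k ω‖ ∂P ≤
      ∫ ω, (X 0 ω - ∫ x, X 0 x ∂P) ^ 2 ∂P + ∫ ω, X 0 ω ^ 2 ∂P := by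
  have := integral_norm_mul_le (P := P) (Y := fun ω => X 0 ω - ∫ x, X 0 x ∂P)
    ((h.memLp 0).sub (memLp_const _)) (h.memLp k)
  rwa [h.integral_sq_eq k] at this

theorem abs_autocovariance_le [IsProbabilityMeasure P]
    (h : IsWeaklyStationary P X) (k : ℤ) :
    |autocovariance P X k| ≤
      ∫ ω, (X 0 ω - ∫ x, X 0 x ∂P) ^ 2 ∂P + ∫ ω, X 0 ω ^ 2 ∂P := by
  rw [autocovariance, covariance_eq_integral_centred_mul (h.memLp 0) (h.memLp k)]
  exact (norm_integral_le_integral_norm _).trans (h.integral_norm_centred_mul_le k)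

/-- Zero variance would make every `X k` equal to `m` almost surely, so `m = V ξ(0)` with `V`
constant. If `V = 0` then `m = 0` and `V = a > 0`; otherwise `ξ(0)` is constant, against `σ > 0`. -/
theorem autocovariance_zero_pos [IsProbabilityMeasure P]
    (h : IsWeaklyStationary P X) (hX : IsSolution P a b ξ X)
    (hS0 : Standing P a b ξ) : 0 < autocovariance P X 0 := by
  have hself : ∀ k, variance (X k) P = autocovariance P X 0 := fun k => by
    rw [← covariance_self (h.memLp k).aemeasurable, h.covariance_eq, sub_self]
  refine lt_of_le_of_ne ((variance_nonneg _ _).trans (hself 0).le) fun h0 => ?_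
  set m := ∫ ω, X 0 ω ∂P with hm
  have hconst : ∀ k, ∀ᵐ ω ∂P, X k ω = m := fun k => by
    filter_upwards [ae_eq_integral_of_variance_eq_zero (h.memLp k)
      ((hself k).trans h0.symm)] with ω hω
    rw [hω, h.mean]
  set V := a + (∑' j : ℕ, b (j + 1)) * m with hV
  have heq : ∀ᵐ ω ∂P, m = V * ξ 0 ω := by
    filter_upwards [ae_all_iff.2 hconst, hX.equation 0] with ω h1 h2
    rw [h1, volatility] at h2
    simp_rw [h1] at h2
    rwa [tsum_mul_right] at h2
  by_cases hV0 : V = 0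
  · obtain ⟨ω, hω⟩ := heq.exists
    rw [hV0, zero_mul] at hω
    rw [hω, mul_zero, add_zero] at hV
    exact hS0.a_pos.ne' (hV.symm.trans hV0)
  · have hξ : ξ 0 =ᵐ[P] fun _ => m / V := by
      filter_upwards [heq] with ω hω
      rw [hω, mul_div_cancel_left₀ _ hV0]
    have : shockStd P ξ = 0 := by
      rw [shockStd, variance_congr hξ, ← Real.sqrt_zero]
      congr 1
      simp [variance_eq_integral]
    exact hS0.std_pos.ne' this

end IsWeaklyStationary

/-- The Yule–Walker equations for the autocovariance function. -/
theorem hasSum_autocovariance [IsProbabilityMeasure P]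
    (hS0 : Standing P a b ξ) (hX : IsSolution P a b ξ X)
    (hstat : IsWeaklyStationary P X) (hS1 : CondS1 (shockMean P ξ) b)
    (hS2 : CondS2 (shockMean P ξ) (shockStd P ξ) b) {k : ℤ} (hk : 1 ≤ k) :
    HasSum (fun j : ℕ => b (j + 1) * autocovariance P X (k - ((j : ℤ) + 1)))
      (autocovariance P X k / shockMean P ξ) := by
  have h := hX.isIIDSquareIntegrable hS0.memLp
  have hc : ∀ t, ∃ g : Ω → ℝ, Measurable[past ξ (t + 1)] g ∧ X t =ᵐ[P] g :=
    hX.exists_measurable_past hS0 hS1 hS2 hstat.memLp (Real.sqrt_nonneg (∫ ω, X 0 ω ^ 2 ∂P))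
      fun k => by rw [MemLp.eLpNorm_two_eq (hstat.memLp k), hstat.integral_sq_eq]
  set c : Ω → ℝ := fun ω => X 0 ω - ∫ x, X 0 x ∂P with hcdef
  have hcL : MemLp c 2 P := (hstat.memLp 0).sub (memLp_const _)
  have hc0 : ∫ ω, c ω ∂P = 0 := by
    rw [integral_sub ((hstat.memLp 0).integrable (by norm_num)) (integrable_const _)]
    simp
  have hcov : ∀ k, autocovariance P X k = ∫ ω, c ω * X k ω ∂P := fun k =>
    covariance_eq_integral_centred_mul (hstat.memLp 0) (hstat.memLp k)
  have hmain : ∫ ω, c ω * X k ω ∂P =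
      (∫ ω, c ω * volatility a b X k ω ∂P) * shockMean P ξ := by
    obtain ⟨g, hg, hge⟩ := hc 0
    obtain ⟨w, hw, hwe⟩ := exists_measurable_past_volatility (a := a) (b := b) hc k
    have hgm : Measurable[past ξ k] g := hg.mono (past_mono ξ (by omega)) le_rfl
    have := h.integral_mul ((hgm.sub_const (∫ x, X 0 x ∂P)).mul hw) measurable_id
    simp only [id, h.integral_eq] at this
    refine Eq.trans ?_ (this.trans ?_)
    · refine integral_congr_ae ?_
      filter_upwards [hge, hwe, hX.equation k] with ω h1 h2 h3
      simp only [Pi.mul_apply]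
      rw [h3, h2, ← h1, mul_assoc]
    · congr 1
      refine integral_congr_ae ?_
      filter_upwards [hge, hwe] with ω h1 h2
      simp only [Pi.mul_apply]
      rw [h2, ← h1]
  have hdiv : autocovariance P X k / shockMean P ξ = ∫ ω, c ω * volatility a b X k ω ∂P := by
    rw [hcov, hmain, mul_div_cancel_right₀ _ hS0.mean_pos.ne']
  -- The constant `a` becomes term 0 of the series; its integral vanishes because `c` is centred.
  obtain ⟨F, hF0, hF⟩ : ∃ F : ℕ → Ω → ℝ, (F 0 = fun ω => a * c ω) ∧
      ∀ j : ℕ, F (j + 1) = fun ω => b (j + 1) * (c ω * X (k - ((j : ℤ) + 1)) ω) :=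
    ⟨fun j => Nat.casesOn j (fun ω => a * c ω)
      fun j ω => b (j + 1) * (c ω * X (k - ((j : ℤ) + 1)) ω), rfl, fun _ => rfl⟩
  have hFi : ∀ j, Integrable (F j) P := fun j => by
    cases j with
    | zero => rw [hF0]; exact (hcL.integrable (by norm_num)).const_mul a
    | succ j => rw [hF]; exact (hcL.integrable_mul (hstat.memLp _)).const_mul _
  have hFs : Summable fun j => ∫ ω, ‖F j ω‖ ∂P := by
    rw [← summable_nat_add_iff 1]
    refine (hS1.1.mul_right (∫ ω, c ω ^ 2 ∂P + ∫ ω, X 0 ω ^ 2 ∂P)).of_nonneg_of_le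
      (fun j => integral_nonneg fun _ => norm_nonneg _) fun j => ?_
    have hb := hX.b_nonneg (j + 1) (by omega)
    calc ∫ ω, ‖F (j + 1) ω‖ ∂P = b (j + 1) * ∫ ω, ‖c ω * X (k - ((j : ℤ) + 1)) ω‖ ∂P := by
          rw [← integral_const_mul]
          refine integral_congr_ae (Filter.Eventually.of_forall fun ω => ?_)
          simp only [hF]
          rw [norm_mul, Real.norm_of_nonneg hb]
      _ ≤ _ := mul_le_mul_of_nonneg_left (hstat.integral_norm_centred_mul_le _) hb
  have hsum := hasSum_integral_of_summable_integral_norm hFi hFs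
  have hpt : ∫ ω, ∑' j, F j ω ∂P = ∫ ω, c ω * volatility a b X k ω ∂P := by
    refine integral_congr_ae ?_
    filter_upwards [hX.summable k] with ω hω
    have hs : Summable fun j => F (j + 1) ω := (hω.mul_left (c ω)).congr fun j => by
      simp only [hF]; ring
    rw [((summable_nat_add_iff (f := fun j => F j ω) 1).1 hs).tsum_eq_zero_add, volatility, mul_add, ← tsum_mul_left]
    congr 1
    · rw [hF0, mul_comm]
    · exact tsum_congr fun j => by simp only [hF]; ring
  rw [hpt, ← hdiv, ← hasSum_nat_add_iff' 1, Finset.sum_range_one] at hsum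
  have hF0i : ∫ ω, F 0 ω ∂P = 0 := by
    rw [hF0, integral_const_mul, hc0, mul_zero]
  rw [hF0i, sub_zero] at hsum
  have hterm : (fun j : ℕ => b (j + 1) * autocovariance P X (k - ((j : ℤ) + 1))) =
      fun j => ∫ ω, F (j + 1) ω ∂P := by
    funext j
    rw [hcov, ← integral_const_mul, hF]
  rw [hterm]
  exact hsum

end ArchInfinity

/-! ### The equivalence -/

theorem theorem5p7 {Ω : Type*} [MeasurableSpace Ω] (P : Measure Ω) [IsProbabilityMeasure P]
    (a : ℝ) (b : ℕ → ℝ) (ξ X : ℤ → Ω → ℝ)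
    (hS0 : ArchInfinity.Standing P a b ξ)
    (hX : ArchInfinity.IsSolution P a b ξ X)
    (hstat : ArchInfinity.IsWeaklyStationary P X)
    (hS1 : ArchInfinity.CondS1 (ArchInfinity.shockMean P ξ) b)
    (hS2 : ArchInfinity.CondS2 (ArchInfinity.shockMean P ξ) (ArchInfinity.shockStd P ξ) b) :
    (∃ α₁ C₁ : ℝ, 0 < α₁ ∧ α₁ < 1 ∧ 0 < C₁ ∧ ∀ k : ℕ, 1 ≤ k → b k ≤ C₁ * α₁ ^ k) ↔
      (∃ α₂ C₂ : ℝ, 0 < α₂ ∧ α₂ < 1 ∧ 0 < C₂ ∧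
        ∀ k : ℕ, ArchInfinity.autocovariance P X (k : ℤ) ≤ C₂ * α₂ ^ k) := by
  have hyw := fun (k : ℤ) (hk : 1 ≤ k) =>
    ArchInfinity.hasSum_autocovariance hS0 hX hstat hS1 hS2 hk
  have hbd := hstat.abs_autocovariance_le
  have hpos := hstat.autocovariance_zero_pos hX hS0
  have hl := hS0.mean_pos
  constructor
  · rintro ⟨α, C, hα, hα1, -, hC⟩
    obtain ⟨R, hR, hs, hR1⟩ :=
      ArchInfinity.exists_one_lt_mul_tsum_mul_pow_lt_one hX.b_nonneg hS1 hα hα1 hC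
    exact ⟨R⁻¹, _, by positivity, inv_lt_one_of_one_lt₀ hR,
      hpos.trans_le ((le_abs_self _).trans (hbd 0)),
      ArchInfinity.le_mul_inv_pow_of_yuleWalker hl hX.b_nonneg hbd hyw hR hs hR1⟩
  · rintro ⟨α, C, hα, hα1, hC0, hC⟩
    have hnn := ArchInfinity.nonneg_of_yuleWalker hl.le hX.b_nonneg hS1 hstat.autocovariance_neg
      hbd hpos.le hyw hl.ne'
    refine ⟨α, C / (ArchInfinity.shockMean P ξ * ArchInfinity.autocovariance P X 0), hα, hα1,
      by positivity, fun k hk => ?_⟩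
    obtain ⟨j, rfl⟩ : ∃ j, k = j + 1 := ⟨k - 1, by omega⟩
    -- Since all terms are nonnegative, the lag-zero term alone bounds `b k * ρ(0)` by `ρ(k) / λ₁`.
    have h1 := le_hasSum (hyw ((j + 1 : ℕ) : ℤ) (by omega)) j fun i _ =>
      mul_nonneg (hX.b_nonneg _ (by omega)) (hnn _)
    rw [show ((j + 1 : ℕ) : ℤ) - ((j : ℤ) + 1) = 0 by omega, le_div_iff₀ hl] at h1
    rw [div_mul_eq_mul_div, le_div_iff₀ (by positivity)]
    linarith [hC (j + 1)]
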